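/- Let $M,N,L\ge 0$ and $I\ge 1$ be integers, $\sigma_n>0$, $\widehat{H}\in\mathbb{C}^{M\times N}$, let $\Psi\in\mathbb{C}^{N\times N}$ and $\Omega_1,\dots,\Omega_I\in\mathbb{C}^{N\times N}$ be Hermitian positive semidefinite and $P_1,\dots,P_I\in\mathbb{R}$. Assume that each matrix $\sigma_n^2\Omega_i+P_i\Psi$ is positive definite; equivalently, $\bar\Omega=\sum_{i=1}^I\alpha_i(\sigma_n^2\Omega_i+P_i\Psi)$ is positive definite for all weights $\alpha_i\ge 0$ that are not all zero. Consider the Bayes-robust matrix-monotonic optimization problem under multiple weighted power constraints $$\max_{F\in\mathbb{C}^{N\times L}}\ F^{\rm H}\widehat{H}^{\rm H}K_n^{-1}\widehat{H}F\quad\text{s.t.}\quad K_n=\bigl(\sigma_n^2+{\rm Tr}(FF^{\rm H}\Psi)\bigr)I,\qquad {\rm Tr}(\Omega_iFF^{\rm H})\le P_i,\ 1\le i\le I,$$ where a feasible $F$ is called Pareto optimal if no feasible $F'$ has an objective matrix that is different from that of $F$ and dominates it in the positive semidefinite order. Then for every Pareto optimal solution $F_{\rm opt}$ there are weights $\alpha_i\ge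 0$ such that $\bar\Omega=\sum_{i=1}^I\alpha_i(\sigma_n^2\Omega_i+P_i\Psi)$ is positive definite, a singular value decomposition $\widehat{H}\bar\Omega^{-1/2}=U_{\mathcal H}\Lambda_{\mathcal H}V_{\mathcal H}^{\rm H}$ (with unitary $U_{\mathcal H}$, $V_{\mathcal H}$ and a rectangular diagonal matrix $\Lambda_{\mathcal H}\ge 0$ whose diagonal entries are not required to be ordered), a rectangular diagonal matrix $\Lambda\in\mathbb{C}^{N\times L}$ with nonnegative real diagonal entries, and a unitary $U_{\rm Arb}\in\mathbb{C}^{L\times L}$, such that $1-{\rm Tr}\bigl(\bar\Omega^{-1/2}\Psi\bar\Omega^{-1/2}V_{\mathcal H}\Lambda\Lambda^{\rm H}V_{\mathcal H}^{\rm H}\bigr)>0$ and $$F_{\rm opt}=\frac{\sigma_n\,\bar\Omega^{-1/2}V_{\mathcal H}\Lambda U_{\rm Arb}^{\rm H}}{\bigl[1-{\rm Tr}\bigl(\bar\Omega^{-1/2}\Psi\bar\Omega^{-1/2}V_{\mathcal H}\Lambda\Lambda^{\rm H}V_{\mathcal H}^{\rm H}\bigr)\bigr]^{1/2}}.$$ Moreover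 $U_{\rm Arb}$ is arbitrary: with the same $\alpha_i$, $V_{\mathcal H}$ and $\Lambda$, the right-hand side is a Pareto optimal solution for every unitary $U_{\rm Arb}\in\mathbb{C}^{L\times L}$. -/

import Mathlib

open scoped Matrix MatrixOrder ComplexOrder

noncomputable section

/-- The noise covariance `K_n = (σ² + Tr(F Fᴴ Ψ)) I` (of size `M`) seen by the precoder `F`. -/
def noiseCov (M : ℕ) {N L : ℕ} (σ : ℝ) (Ψ : Matrix (Fin N) (Fin N) ℂ)
    (F : Matrix (Fin N) (Fin L) ℂ) : Matrix (Fin M) (Fin M) ℂ :=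
  ((σ : ℂ) ^ 2 + (F * Fᴴ * Ψ).trace) • (1 : Matrix (Fin M) (Fin M) ℂ)

/-- The matrix-valued objective `Fᴴ Ĥᴴ K_n⁻¹ Ĥ F`. -/
def bayesObjective {M N L : ℕ} (σ : ℝ) (H : Matrix (Fin M) (Fin N) ℂ)
    (Ψ : Matrix (Fin N) (Fin N) ℂ) (F : Matrix (Fin N) (Fin L) ℂ) :
    Matrix (Fin L) (Fin L) ℂ :=
  Fᴴ * Hᴴ * (noiseCov M σ Ψ F)⁻¹ * H * F

/-- The multiple weighted power constraints `Tr(Ω_i F Fᴴ) ≤ P_i`. For `Ω_i` positive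
semidefinite these traces are real, so nothing is lost by taking the real part. -/
def powerFeasible {N L I : ℕ} (Ω : Fin I → Matrix (Fin N) (Fin N) ℂ) (P : Fin I → ℝ) :
    Set (Matrix (Fin N) (Fin L) ℂ) :=
  {F | ∀ i, (Ω i * F * Fᴴ).trace.re ≤ P i}

/-- `x` is a Pareto optimal solution of the maximization of the matrix-valued `f` over `S`, in the
positive semidefinite order: no feasible `y` has `f y ⪰ f x` and `f y ≠ f x`. -/
def IsParetoMax {X : Type*} {L : ℕ} (S : Set X) (f : X → Matrix (Fin L) (Fin L) ℂ) (x : X) :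
    Prop :=
  x ∈ S ∧ ∀ y ∈ S, (f y - f x).PosSemidef → f y = f x

/-- Pareto optimal solutions of Bayes-robust matrix-monotonic optimization under multiple
weighted power constraints. -/
def IsBayesPareto {M N L I : ℕ} (σ : ℝ) (H : Matrix (Fin M) (Fin N) ℂ)
    (Ψ : Matrix (Fin N) (Fin N) ℂ) (Ω : Fin I → Matrix (Fin N) (Fin N) ℂ) (P : Fin I → ℝ)
    (F : Matrix (Fin N) (Fin L) ℂ) : Prop :=
  IsParetoMax (powerFeasible Ω P) (bayesObjective σ H Ψ) F

/-- `Ω̄ = ∑ i, α_i (σ² Ω_i + P_i Ψ)`. -/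
def weightedOmega {N I : ℕ} (σ : ℝ) (Ψ : Matrix (Fin N) (Fin N) ℂ)
    (Ω : Fin I → Matrix (Fin N) (Fin N) ℂ) (P α : Fin I → ℝ) : Matrix (Fin N) (Fin N) ℂ :=
  ∑ i, (α i : ℂ) • ((σ : ℂ) ^ 2 • Ω i + (P i : ℂ) • Ψ)

/-- `A^{-1/2}`: the inverse of the positive semidefinite Hermitian square root of `A`
(meaningful for positive definite `A`). -/
def invSqrt {N : ℕ} (A : Matrix (Fin N) (Fin N) ℂ) : Matrix (Fin N) (Fin N) ℂ :=
  (CFC.sqrt A)⁻¹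

/-- A rectangular diagonal matrix with nonnegative real diagonal entries (the order `0 ≤ z` on `ℂ`
says that `z` is real and nonnegative). -/
def IsNonnegRectDiag {m n : ℕ} (Λ : Matrix (Fin m) (Fin n) ℂ) : Prop :=
  ∀ i j, 0 ≤ Λ i j ∧ ((i : ℕ) ≠ (j : ℕ) → Λ i j = 0)

/-- `A = U Λ Vᴴ` is a singular value decomposition. No order of the singular values is imposed. -/
def IsSVD {m n : ℕ} (A : Matrix (Fin m) (Fin n) ℂ) (U : Matrix (Fin m) (Fin m) ℂ)
    (Λ : Matrix (Fin m) (Fin n) ℂ) (V : Matrix (Fin n) (Fin n) ℂ) : Prop :=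
  U ∈ Matrix.unitaryGroup (Fin m) ℂ ∧ V ∈ Matrix.unitaryGroup (Fin n) ℂ ∧
    IsNonnegRectDiag Λ ∧ A = U * Λ * Vᴴ

/-- The bracket `1 - Tr(Ω̄^{-1/2} Ψ Ω̄^{-1/2} V Λ Λᴴ Vᴴ)`; the trace is real when `Ω̄` and `Ψ` are
positive semidefinite. -/
def structureGap {N L : ℕ} (Ψ Ωbar V : Matrix (Fin N) (Fin N) ℂ) (Λ : Matrix (Fin N) (Fin L) ℂ) :
    ℝ :=
  1 - (invSqrt Ωbar * Ψ * invSqrt Ωbar * V * Λ * Λᴴ * Vᴴ).trace.re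

/-- The matrix `σ Ω̄^{-1/2} V Λ Uᴴ / [1 - Tr(Ω̄^{-1/2} Ψ Ω̄^{-1/2} V Λ Λᴴ Vᴴ)]^{1/2}`. -/
def structuredSolution {N L : ℕ} (σ : ℝ) (Ψ Ωbar V : Matrix (Fin N) (Fin N) ℂ)
    (Λ : Matrix (Fin N) (Fin L) ℂ) (U : Matrix (Fin L) (Fin L) ℂ) : Matrix (Fin N) (Fin L) ℂ :=
  ((σ / Real.sqrt (structureGap Ψ Ωbar V Λ) : ℝ) : ℂ) • (invSqrt Ωbar * V * Λ * Uᴴ)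

end

/-!
Substituting `X = F / (σ² + Tr(F Fᴴ Ψ))^{1/2}` removes the noise covariance: the objective becomes
`Xᴴ Hᴴ H X`, and the constraints become `Tr(A_i X Xᴴ) ≤ P_i` with `A_i = σ² Ω_i + P_i Ψ` positive
definite, together with `Tr(Ψ X Xᴴ) < 1` (`IsBayesPareto.exists_normalized`).

The problem is not convex, but the structure only needs first-order conditions. Assume `H X ≠ 0` and
let `E` be a direction with `(H X)ᴴ (H E)` skew-Hermitian. Moving from `X` along `X + E` increases
the objective strictly in the semidefinite order, so it violates some linearized constraint.
By separation in `ℝ^I` there are weights `α ≥ 0`, not all zero, such that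
`Ω̄ = ∑ α_i A_i` satisfies `Re Tr(Ω̄ X Eᴴ) = 0` for all these `E` (`exists_multipliers`).

Taking `E = C Hᴴ H X` with `C` skew-Hermitian shows that `Ω̄ X Xᴴ Hᴴ H` is Hermitian, and taking `E`
with columns in `ker H` shows that `Ω̄ X` is orthogonal to `ker H` (`exists_weights`). In terms of
`Y = Ω̄^{1/2} X`, the matrices `Y Yᴴ` and `(H Ω̄^{-1/2})ᴴ (H Ω̄^{-1/2})` commute and their kernels
are nested. They are diagonalized by a common unitary `V`, whose columns can be ordered so that the
nonzero eigenvalues of both come first; this is what makes `V` a factor in rectangular singular value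
decompositions of both `H Ω̄^{-1/2}` and `Y` (`exists_isSVD_common`). If `H X = 0`, optimality forces
`H = 0` or `X = 0`, and any positive weights do.

That the right unitary factor is arbitrary is the unitary invariance of the whole problem
(`IsBayesPareto.mul_unitary`).
-/

/-! ### Singular value decompositions with a common factor -/

/-- A unitary `V` that diagonalizes `Aᴴ A` is the right factor of a singular value decomposition of
`A`, provided that the nonzero eigenvalues sit at indices below the number `m` of rows: the `j`-th
column of `A V` is then the `j`-th singular value times the `j`-th left singular vector. -/
theorem exists_isSVD_of_diagonal {m n : ℕ} (A : Matrix (Fin m) (Fin n) ℂ)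
    (V : Matrix (Fin n) (Fin n) ℂ) (hV : V ∈ Matrix.unitaryGroup (Fin n) ℂ) (d : Fin n → ℂ)
    (hd : Vᴴ * (Aᴴ * A) * V = Matrix.diagonal d) (h0 : ∀ j : Fin n, m ≤ (j : ℕ) → d j = 0) :
    ∃ U Λ, IsSVD A U Λ V := by
  have hCC : (A * V)ᴴ * (A * V) = Matrix.diagonal d := by
    rw [← hd, Matrix.conjTranspose_mul]; simp only [Matrix.mul_assoc]
  set c : Fin n → EuclideanSpace ℂ (Fin m) := fun j => WithLp.toLp 2 (fun i => (A * V) i j) with hc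
  have hinner : ∀ i j, inner ℂ (c i) (c j) = if i = j then d i else 0 := by
    intro i j
    have := congrFun (congrFun hCC i) j
    rw [Matrix.diagonal_apply, Matrix.mul_apply] at this
    rw [← this, PiLp.inner_apply]
    simp [hc, Matrix.conjTranspose_apply, mul_comm]
  have hcz : ∀ j : Fin n, m ≤ (j : ℕ) → c j = 0 := by
    intro j hj
    have := hinner j j
    rwa [if_pos rfl, h0 j hj, inner_self_eq_zero] at this
  let w : Fin m → EuclideanSpace ℂ (Fin m) := fun i =>
    if h : (i : ℕ) < n then ((‖c ⟨i, h⟩‖⁻¹ : ℝ) : ℂ) • c ⟨i, h⟩ else 0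
  let s : Set (Fin m) := {i | ∃ h : (i : ℕ) < n, c ⟨i, h⟩ ≠ 0}
  have hw : Orthonormal ℂ (s.domRestrict w) := by
    constructor
    · rintro ⟨i, h, hi⟩
      have : ‖c ⟨i, h⟩‖ ≠ 0 := norm_ne_zero_iff.mpr hi
      simp [Set.domRestrict, w, h, norm_smul, this]
    · rintro ⟨i, h, hi⟩ ⟨j, h', hj⟩ hij
      have hij' : (⟨i, h⟩ : Fin n) ≠ ⟨j, h'⟩ := by
        intro e
        exact hij (Subtype.ext (Fin.ext (by simpa using e)))
      have hwi : w i = ((‖c ⟨i, h⟩‖⁻¹ : ℝ) : ℂ) • c ⟨i, h⟩ := dif_pos h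
      have hwj : w j = ((‖c ⟨j, h'⟩‖⁻¹ : ℝ) : ℂ) • c ⟨j, h'⟩ := dif_pos h'
      change inner ℂ (w i) (w j) = 0
      rw [hwi, hwj, inner_smul_left, inner_smul_right, hinner, if_neg hij', mul_zero, mul_zero]
  obtain ⟨b, hb⟩ := hw.exists_orthonormalBasis_extension_of_card_eq (by simp)
  refine ⟨Matrix.of fun i k => b k i,
    Matrix.of fun (i : Fin m) (j : Fin n) => if (i : ℕ) = j then (‖c j‖ : ℂ) else 0,
    ?_, hV, ?_, ?_⟩
  · rw [Matrix.mem_unitaryGroup_iff']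
    ext i j
    have := orthonormal_iff_ite.mp b.orthonormal i j
    rw [PiLp.inner_apply] at this
    simpa [Matrix.mul_apply, Matrix.one_apply, mul_comm] using this
  · intro i j
    constructor
    · simp only [Matrix.of_apply]
      split_ifs
      · exact_mod_cast norm_nonneg (c j)
      · rfl
    · intro h
      simp [h]
  · have key : A * V = (Matrix.of fun i k => b k i) *
        (Matrix.of fun (i : Fin m) (j : Fin n) => if (i : ℕ) = j then (‖c j‖ : ℂ) else 0) := by
      ext i j
      have hij : (A * V) i j = c j i := rfl
      rw [hij, Matrix.mul_apply]
      simp only [Matrix.of_apply]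
      by_cases hj : (j : ℕ) < m
      · rw [Finset.sum_eq_single (⟨j, hj⟩ : Fin m)]
        · simp only [if_true]
          by_cases hcj : c j = 0
          · simp [hcj]
          · have hs : (⟨j, hj⟩ : Fin m) ∈ s := ⟨j.2, hcj⟩
            have hn : (‖c j‖ : ℂ) ≠ 0 := by exact_mod_cast norm_ne_zero_iff.mpr hcj
            rw [hb _ hs]
            simp only [w, Fin.is_lt, dif_pos, Fin.eta]
            simp
            field_simp
        · intro k _ hk
          rw [if_neg, mul_zero]
          intro e; exact hk (Fin.ext e)
        · simp
      · rw [hcz j (not_lt.mp hj)]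
        simp
    rw [← key, Matrix.mul_assoc, ← Matrix.star_eq_conjTranspose,
      Matrix.mem_unitaryGroup_iff.mp hV, Matrix.mul_one]

/-- Commuting Hermitian matrices are diagonalized by one unitary matrix. -/
theorem exists_unitary_diagonalize_of_commute {n : ℕ} (A B : Matrix (Fin n) (Fin n) ℂ)
    (hA : A.IsHermitian) (hB : B.IsHermitian) (hAB : Commute A B) :
    ∃ V ∈ Matrix.unitaryGroup (Fin n) ℂ, ∃ a b : Fin n → ℂ,
      Vᴴ * A * V = Matrix.diagonal a ∧ Vᴴ * B * V = Matrix.diagonal b := by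
  classical
  have hsA := Matrix.isSymmetric_toEuclideanLin_iff.mpr hA
  have hsB := Matrix.isSymmetric_toEuclideanLin_iff.mpr hB
  have hc : Commute (Matrix.toEuclideanLin A) (Matrix.toEuclideanLin B) := by
    rw [commute_iff_eq]
    apply LinearMap.ext
    intro x
    have : A * B = B * A := hAB
    simp [Matrix.toLpLin_apply, this]
  have hint := hsA.directSum_isInternal_of_commute hsB hc
  have hort := hsA.orthogonalFamily_eigenspace_inf_eigenspace hsB
  -- There are infinitely many candidate eigenvalue pairs; only the finitely many with a nonzero joint
  -- eigenspace are kept, to obtain an orthonormal basis indexed by `Fin n`.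
  have hint' := DirectSum.isInternal_ne_bot_iff.mpr hint
  have hfin := WellFoundedGT.finite_ne_bot_of_iSupIndep hort.independent
  have : Fintype {i : ℂ × ℂ // Module.End.eigenspace (Matrix.toEuclideanLin A) i.2 ⊓
      Module.End.eigenspace (Matrix.toEuclideanLin B) i.1 ≠ ⊥} := hfin.fintype
  have hort' := hort.comp (Subtype.val_injective (p := fun i : ℂ × ℂ =>
    Module.End.eigenspace (Matrix.toEuclideanLin A) i.2 ⊓
      Module.End.eigenspace (Matrix.toEuclideanLin B) i.1 ≠ ⊥))
  have hn : Module.finrank ℂ (EuclideanSpace ℂ (Fin n)) = n := finrank_euclideanSpace_fin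
  let b := hint'.subordinateOrthonormalBasis hn hort'
  let ev := fun j => (hint'.subordinateOrthonormalBasisIndex hn j hort').1
  have hb : ∀ j, b j ∈ Module.End.eigenspace (Matrix.toEuclideanLin A) (ev j).2 ⊓
      Module.End.eigenspace (Matrix.toEuclideanLin B) (ev j).1 :=
    fun j => hint'.subordinateOrthonormalBasis_subordinate hn j hort'
  let V : Matrix (Fin n) (Fin n) ℂ := Matrix.of fun i j => b j i
  have hV : Vᴴ * V = 1 := by
    ext i j
    have := orthonormal_iff_ite.mp b.orthonormal i j
    rw [PiLp.inner_apply] at this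
    simpa [V, Matrix.mul_apply, Matrix.one_apply, mul_comm] using this
  have hdiag : ∀ (Z : Matrix (Fin n) (Fin n) ℂ) (d : Fin n → ℂ),
      (∀ j, b j ∈ Module.End.eigenspace (Matrix.toEuclideanLin Z) (d j)) →
      Vᴴ * Z * V = Matrix.diagonal d := by
    intro Z d hZ
    have h1 : Z * V = V * Matrix.diagonal d := by
      ext i j
      have h2 := congrArg (fun v : EuclideanSpace ℂ (Fin n) => v i)
        (Module.End.mem_eigenspace_iff.mp (hZ j))
      rw [Matrix.mul_diagonal]
      simpa [Matrix.toLpLin_apply, Matrix.mulVec, dotProduct, Matrix.mul_apply, V, mul_comm] using h2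
    rw [Matrix.mul_assoc, h1, ← Matrix.mul_assoc, hV, Matrix.one_mul]
  exact ⟨V, Matrix.mem_unitaryGroup_iff'.mpr hV, fun j => (ev j).2, fun j => (ev j).1,
    hdiag A _ fun j => (hb j).1, hdiag B _ fun j => (hb j).2⟩

/-- If one of the supports of `a` and `b` contains the other, a single permutation moves both to
initial segments. Without nesting this can fail, which is why commutation alone does not give two
rectangular singular value decompositions with a common factor. -/
theorem exists_perm_support_lt {n p q : ℕ} (a b : Fin n → ℂ)
    (ha : Fintype.card {i // a i ≠ 0} ≤ p) (hb : Fintype.card {i // b i ≠ 0} ≤ q)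
    (hab : (∀ i, a i = 0 → b i = 0) ∨ (∀ i, b i = 0 → a i = 0)) :
    ∃ e : Equiv.Perm (Fin n), (∀ j : Fin n, p ≤ (j : ℕ) → a (e j) = 0) ∧
      (∀ j : Fin n, q ≤ (j : ℕ) → b (e j) = 0) := by
  classical
  -- Sorting by the number of vanishing entries puts the smaller support first, then the rest of
  -- the larger one.
  let f : Fin n → ℕ := fun i => (if a i = 0 then 1 else 0) + (if b i = 0 then 1 else 0)
  have hmono := Tuple.monotone_sort f
  have aux : ∀ (c : Fin n → ℂ) (r : ℕ), Fintype.card {i // c i ≠ 0} ≤ r →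
      (∀ i j, f i ≤ f j → c j ≠ 0 → c i ≠ 0) → ∀ j : Fin n, r ≤ (j : ℕ) → c (Tuple.sort f j) = 0 := by
    intro c r hr hlow j hj
    by_contra hcj
    have h1 : ((Finset.Iic j).map (Tuple.sort f).toEmbedding) ⊆ Finset.univ.filter (c · ≠ 0) := by
      intro x hx
      rw [Finset.mem_map] at hx
      obtain ⟨k, hk, rfl⟩ := hx
      simp only [Finset.mem_filter, Finset.mem_univ, true_and]
      exact hlow _ _ (hmono (Finset.mem_Iic.mp hk)) hcj
    have h2 := Finset.card_le_card h1
    rw [Finset.card_map, Fin.card_Iic, ← Fintype.card_subtype] at h2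
    omega
  refine ⟨Tuple.sort f, aux a p ha ?_, aux b q hb ?_⟩ <;>
  · intro i j hij hj hi
    simp only [f] at hij
    rcases hab with h | h <;> have h1 := h i <;> have h2 := h j <;> simp_all <;>
      split_ifs at hij <;> simp_all

/-- `A` and `Y` have singular value decompositions with the same right factor when `Aᴴ A` and `Yᴴ Y`
commute and the kernels of `A` and `Y` are nested. -/
theorem exists_isSVD_common {m n l : ℕ} (A : Matrix (Fin m) (Fin n) ℂ) (Y : Matrix (Fin l) (Fin n) ℂ)
    (hcomm : Commute (Aᴴ * A) (Yᴴ * Y))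
    (hker : (∀ v, A *ᵥ v = 0 → Y *ᵥ v = 0) ∨ (∀ v, Y *ᵥ v = 0 → A *ᵥ v = 0)) :
    ∃ U Λ U' Λ' V, IsSVD A U Λ V ∧ IsSVD Y U' Λ' V := by
  classical
  obtain ⟨V, hV, a, b, ha, hb⟩ := exists_unitary_diagonalize_of_commute _ _
    (Matrix.isHermitian_conjTranspose_mul_self A) (Matrix.isHermitian_conjTranspose_mul_self Y) hcomm
  have hcard : ∀ {r : ℕ} (Z : Matrix (Fin r) (Fin n) ℂ) (d : Fin n → ℂ),
      Vᴴ * (Zᴴ * Z) * V = Matrix.diagonal d → Fintype.card {i // d i ≠ 0} ≤ r := by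
    intro r Z d hd
    rw [← Matrix.rank_diagonal, ← hd]
    calc _ ≤ (Vᴴ * (Zᴴ * Z)).rank := Matrix.rank_mul_le_left _ _
      _ ≤ (Zᴴ * Z).rank := Matrix.rank_mul_le_right _ _
      _ ≤ Z.rank := Matrix.rank_mul_le_right _ _
      _ ≤ r := Z.rank_le_height
  have hzero : ∀ {r : ℕ} (Z : Matrix (Fin r) (Fin n) ℂ) (d : Fin n → ℂ),
      Vᴴ * (Zᴴ * Z) * V = Matrix.diagonal d → ∀ i, d i = 0 ↔ Z *ᵥ (V.col i) = 0 := by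
    intro r Z d hd i
    have h1 : d i = star (Z *ᵥ V.col i) ⬝ᵥ (Z *ᵥ V.col i) := by
      have := congrFun (congrFun hd i) i
      rw [Matrix.diagonal_apply_eq] at this
      have h2 : Vᴴ * (Zᴴ * Z) * V = (Z * V)ᴴ * (Z * V) := by
        rw [Matrix.conjTranspose_mul]; simp only [Matrix.mul_assoc]
      rw [← this, h2, Matrix.mul_apply]
      rfl
    rw [h1, dotProduct_star_self_eq_zero]
  obtain ⟨e, he1, he2⟩ := exists_perm_support_lt a b (hcard A a ha) (hcard Y b hb) (by
    refine hker.imp (fun h i hi => ?_) (fun h i hi => ?_)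
    · rw [hzero Y b hb]; exact h _ ((hzero A a ha i).mp hi)
    · rw [hzero A a ha]; exact h _ ((hzero Y b hb i).mp hi))
  have hW : V.submatrix id e ∈ Matrix.unitaryGroup (Fin n) ℂ := by
    rw [Matrix.mem_unitaryGroup_iff'] at hV ⊢
    rw [Matrix.star_eq_conjTranspose] at hV ⊢
    rw [Matrix.conjTranspose_submatrix, ← Matrix.submatrix_mul _ _ _ _ _ Function.bijective_id, hV,
      Matrix.submatrix_one_equiv]
  have hdiag : ∀ (B : Matrix (Fin n) (Fin n) ℂ) (d : Fin n → ℂ), Vᴴ * B * V = Matrix.diagonal d →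
      (V.submatrix id e)ᴴ * B * V.submatrix id e = Matrix.diagonal (d ∘ e) := by
    intro B d hd
    rw [← Matrix.submatrix_diagonal_equiv, ← hd]
    rfl
  obtain ⟨U, Λ, h1⟩ := exists_isSVD_of_diagonal A _ hW _ (hdiag _ _ ha) he1
  obtain ⟨U', Λ', h2⟩ := exists_isSVD_of_diagonal Y _ hW _ (hdiag _ _ hb) he2
  exact ⟨U, Λ, U', Λ', _, h1, h2⟩

/-! ### Weighted power forms -/

/-- The real bilinear form `Re Tr(A X Dᴴ)`; for Hermitian `A` it is half the derivative of
`powerForm A` at `X` in the direction `D`. -/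
noncomputable def powerPairing {N L : ℕ} (A : Matrix (Fin N) (Fin N) ℂ)
    (X D : Matrix (Fin N) (Fin L) ℂ) : ℝ :=
  (A * X * Dᴴ).trace.re

/-- The power `Tr(A X Xᴴ)` of `X` weighted by `A`. The trace is real for Hermitian `A`, so the real
part loses nothing. -/
noncomputable def powerForm {N L : ℕ} (A : Matrix (Fin N) (Fin N) ℂ)
    (X : Matrix (Fin N) (Fin L) ℂ) : ℝ :=
  powerPairing A X X

section powerForm
variable {N L : ℕ} {A : Matrix (Fin N) (Fin N) ℂ}

theorem powerPairing_add (X D E : Matrix (Fin N) (Fin L) ℂ) :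
    powerPairing A X (D + E) = powerPairing A X D + powerPairing A X E := by
  simp [powerPairing, Matrix.mul_add]

theorem powerPairing_smul (X D : Matrix (Fin N) (Fin L) ℂ) (t : ℝ) :
    powerPairing A X ((t : ℂ) • D) = t * powerPairing A X D := by
  simp [powerPairing, Matrix.conjTranspose_smul]

theorem powerPairing_comm (hA : A.IsHermitian) (X D : Matrix (Fin N) (Fin L) ℂ) :
    powerPairing A D X = powerPairing A X D := by
  unfold powerPairing
  have : (A * D * Xᴴ).trace = star (A * X * Dᴴ).trace := by
    rw [← Matrix.trace_conjTranspose, Matrix.conjTranspose_mul, Matrix.conjTranspose_mul,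
      Matrix.conjTranspose_conjTranspose, hA.eq, ← Matrix.mul_assoc, Matrix.trace_mul_comm,
      ← Matrix.mul_assoc, Matrix.mul_assoc D, Matrix.trace_mul_comm D]
  rw [this]
  simp

theorem powerPairing_weighted {I : ℕ} (B : Fin I → Matrix (Fin N) (Fin N) ℂ) (α : Fin I → ℝ)
    (X D : Matrix (Fin N) (Fin L) ℂ) :
    powerPairing (∑ i, (α i : ℂ) • B i) X D = ∑ i, α i * powerPairing (B i) X D := by
  simp [powerPairing, Matrix.sum_mul, Matrix.trace_sum]

theorem powerForm_smul (X : Matrix (Fin N) (Fin L) ℂ) (t : ℝ) :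
    powerForm A ((t : ℂ) • X) = t ^ 2 * powerForm A X := by
  simp [powerForm, powerPairing, Matrix.conjTranspose_smul]
  ring

theorem powerForm_add_smul (hA : A.IsHermitian) (X D : Matrix (Fin N) (Fin L) ℂ) (t : ℝ) :
    powerForm A (X + (t : ℂ) • D) =
      powerForm A X + 2 * t * powerPairing A X D + t ^ 2 * powerForm A D := by
  have h := powerPairing_comm hA X D
  simp only [powerForm, powerPairing] at h ⊢
  simp only [Matrix.mul_add, Matrix.add_mul, Matrix.conjTranspose_add, Matrix.conjTranspose_smul,
    Matrix.trace_add, Matrix.smul_mul, Matrix.mul_smul, Matrix.trace_smul, Complex.add_re]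
  simp [h]
  ring

theorem trace_mul_mul_conjTranspose_eq (A : Matrix (Fin N) (Fin N) ℂ)
    (X : Matrix (Fin N) (Fin L) ℂ) : (A * X * Xᴴ).trace = (Xᴴ * A * X).trace := by
  rw [Matrix.trace_mul_comm, ← Matrix.mul_assoc]

theorem powerForm_nonneg (hA : A.PosSemidef) (X : Matrix (Fin N) (Fin L) ℂ) :
    0 ≤ powerForm A X := by
  have := (hA.conjTranspose_mul_mul_same X).trace_nonneg
  rw [← trace_mul_mul_conjTranspose_eq] at this
  exact (Complex.nonneg_iff.mp this).1

theorem trace_eq_powerForm (hA : A.PosSemidef) (X : Matrix (Fin N) (Fin L) ℂ) :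
    (A * X * Xᴴ).trace = (powerForm A X : ℂ) := by
  have := (hA.conjTranspose_mul_mul_same X).trace_nonneg
  rw [← trace_mul_mul_conjTranspose_eq] at this
  exact Complex.ext rfl (by simpa using (Complex.nonneg_iff.mp this).2.symm)

theorem powerForm_pos (hA : A.PosDef) {X : Matrix (Fin N) (Fin L) ℂ} (hX : X ≠ 0) :
    0 < powerForm A X := by
  refine lt_of_le_of_ne (powerForm_nonneg hA.posSemidef X) fun h => hX ?_
  have h0 : (Xᴴ * A * X).trace = 0 := by
    rw [← trace_mul_mul_conjTranspose_eq, trace_eq_powerForm hA.posSemidef, ← h]; simp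
  have h1 := (hA.posSemidef.conjTranspose_mul_mul_same X).trace_eq_zero_iff.mp h0
  ext k j
  by_contra hk
  have hne : X.col j ≠ 0 := fun e => hk (congrFun e k)
  have h2 := hA.dotProduct_mulVec_pos hne
  have h3 : star (X.col j) ⬝ᵥ (A *ᵥ X.col j) = (Xᴴ * A * X) j j := by
    rw [Matrix.mul_assoc, Matrix.mul_apply]; rfl
  rw [h3, h1] at h2
  simp at h2

theorem powerForm_pencil (Ω Ψ : Matrix (Fin N) (Fin N) ℂ) (σ p : ℝ)
    (X : Matrix (Fin N) (Fin L) ℂ) :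
    powerForm ((σ : ℂ) ^ 2 • Ω + (p : ℂ) • Ψ) X = σ ^ 2 * powerForm Ω X + p * powerForm Ψ X := by
  simp only [powerForm, powerPairing, Matrix.add_mul, Matrix.smul_mul, Matrix.trace_add,
    Matrix.trace_smul, smul_eq_mul, Complex.add_re, ← Complex.ofReal_pow, Complex.re_ofReal_mul]

end powerForm

/-! ### Removing the noise covariance -/

theorem bayesObjective_eq {M N L : ℕ} {σ : ℝ} (hσ : 0 < σ) (H : Matrix (Fin M) (Fin N) ℂ)
    {Ψ : Matrix (Fin N) (Fin N) ℂ} (hΨ : Ψ.PosSemidef) (F : Matrix (Fin N) (Fin L) ℂ) :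
    bayesObjective σ H Ψ F = (((σ ^ 2 + powerForm Ψ F)⁻¹ : ℝ) : ℂ) • ((H * F)ᴴ * (H * F)) := by
  have hs : ((σ ^ 2 + powerForm Ψ F : ℝ) : ℂ) ≠ 0 := by
    have := powerForm_nonneg hΨ F
    exact_mod_cast (by positivity : σ ^ 2 + powerForm Ψ F ≠ 0)
  have htr : (F * Fᴴ * Ψ).trace = (powerForm Ψ F : ℂ) := by
    rw [Matrix.trace_mul_comm, ← Matrix.mul_assoc, trace_eq_powerForm hΨ]
  have hinv : (noiseCov M σ Ψ F)⁻¹ =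
      (((σ ^ 2 + powerForm Ψ F)⁻¹ : ℝ) : ℂ) • (1 : Matrix (Fin M) (Fin M) ℂ) := by
    apply Matrix.inv_eq_right_inv
    rw [noiseCov, htr, Matrix.smul_mul, Matrix.one_mul, smul_smul, ← Complex.ofReal_pow,
      ← Complex.ofReal_add, Complex.ofReal_inv, mul_inv_cancel₀ hs, one_smul]
  rw [bayesObjective, hinv, Matrix.conjTranspose_mul]
  simp only [Matrix.mul_smul, Matrix.smul_mul, Matrix.mul_one, Matrix.mul_assoc]

/-- The constraint set in the normalized variable `X = F / (σ² + Tr(F Fᴴ Ψ))^{1/2}`. With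
`A i = σ² Ω i + P i Ψ` it is the image of `powerFeasible Ω P`; the objective there is
`(H X)ᴴ (H X)`, without the noise covariance. -/
def normalizedFeasible {N L I : ℕ} (A : Fin I → Matrix (Fin N) (Fin N) ℂ)
    (Ψ : Matrix (Fin N) (Fin N) ℂ) (P : Fin I → ℝ) : Set (Matrix (Fin N) (Fin L) ℂ) :=
  {X | (∀ i, powerForm (A i) X ≤ P i) ∧ powerForm Ψ X < 1}

section normalization
variable {M N L I : ℕ} {σ : ℝ} (H : Matrix (Fin M) (Fin N) ℂ) {Ψ : Matrix (Fin N) (Fin N) ℂ}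
  {Ω : Fin I → Matrix (Fin N) (Fin N) ℂ} {P : Fin I → ℝ}

/-- Undoing the normalization, `F = σ X / (1 - Tr(Ψ X Xᴴ))^{1/2}`, turns the objective at `F` into
the Gram matrix of `H X`. -/
theorem bayesObjective_denormalize (hσ : 0 < σ) (hΨ : Ψ.PosSemidef)
    {X : Matrix (Fin N) (Fin L) ℂ} (hX : powerForm Ψ X < 1) :
    bayesObjective σ H Ψ (((σ / √(1 - powerForm Ψ X) : ℝ) : ℂ) • X) = (H * X)ᴴ * (H * X) := by
  have hg : 0 < 1 - powerForm Ψ X := by linarith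
  rw [bayesObjective_eq hσ H hΨ, powerForm_smul, div_pow, Real.sq_sqrt hg.le]
  simp only [Matrix.mul_smul, Matrix.conjTranspose_smul, Matrix.smul_mul, smul_smul]
  rw [Complex.star_def, Complex.conj_ofReal, ← Complex.ofReal_mul, ← Complex.ofReal_mul]
  convert one_smul ℂ _
  have h1 : σ / √(1 - powerForm Ψ X) * (σ / √(1 - powerForm Ψ X)) = σ ^ 2 / (1 - powerForm Ψ X) := by
    rw [← sq, div_pow, Real.sq_sqrt hg.le]
  have h2 : σ ^ 2 + σ ^ 2 / (1 - powerForm Ψ X) * powerForm Ψ X = σ ^ 2 / (1 - powerForm Ψ X) := by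
    field_simp; ring
  rw [h1, h2, inv_mul_cancel₀ (by positivity)]
  simp

theorem powerFeasible_denormalize {X : Matrix (Fin N) (Fin L) ℂ}
    (hX : X ∈ normalizedFeasible (fun i => (σ : ℂ) ^ 2 • Ω i + (P i : ℂ) • Ψ) Ψ P) :
    ((σ / √(1 - powerForm Ψ X) : ℝ) : ℂ) • X ∈ powerFeasible Ω P := by
  have hg : 0 < 1 - powerForm Ψ X := by linarith [hX.2]
  intro i
  change powerForm (Ω i) _ ≤ P i
  have h := hX.1 i
  rw [powerForm_pencil] at h
  rw [powerForm_smul, div_pow, Real.sq_sqrt hg.le, div_mul_eq_mul_div, div_le_iff₀ hg]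
  linarith

theorem exists_normalize (hσ : 0 < σ) (hΨ : Ψ.PosSemidef)
    {F : Matrix (Fin N) (Fin L) ℂ} (hF : F ∈ powerFeasible Ω P) :
    ∃ X ∈ normalizedFeasible (fun i => (σ : ℂ) ^ 2 • Ω i + (P i : ℂ) • Ψ) Ψ P,
      F = ((σ / √(1 - powerForm Ψ X) : ℝ) : ℂ) • X := by
  have hp := powerForm_nonneg hΨ F
  set s := σ ^ 2 + powerForm Ψ F with hs
  have hs0 : 0 < s := by positivity
  have hΨX : powerForm Ψ ((((√s)⁻¹ : ℝ) : ℂ) • F) = powerForm Ψ F / s := by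
    rw [powerForm_smul, inv_pow, Real.sq_sqrt hs0.le]; ring
  have hgap : 1 - powerForm Ψ F / s = σ ^ 2 / s := by
    field_simp; rw [hs]; ring
  refine ⟨(((√s)⁻¹ : ℝ) : ℂ) • F, ⟨fun i => ?_, ?_⟩, ?_⟩
  · have h : powerForm (Ω i) F ≤ P i := hF i
    rw [powerForm_pencil, hΨX, powerForm_smul, inv_pow, Real.sq_sqrt hs0.le]
    have : σ ^ 2 * (s⁻¹ * powerForm (Ω i) F) ≤ σ ^ 2 * (s⁻¹ * P i) := by gcongr
    have h2 : σ ^ 2 * (s⁻¹ * P i) = P i * (1 - powerForm Ψ F / s) := by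
      rw [hgap]; ring
    linarith
  · rw [hΨX]
    have : 0 < σ ^ 2 / s := by positivity
    linarith
  · rw [hΨX, hgap, Real.sqrt_div (by positivity), Real.sqrt_sq hσ.le, smul_smul,
      ← Complex.ofReal_mul]
    have h1 : √s ≠ 0 := (Real.sqrt_pos.mpr hs0).ne'
    have : σ / (σ / √s) * (√s)⁻¹ = 1 := by field_simp
    rw [this]; simp

theorem IsBayesPareto.exists_normalized (hσ : 0 < σ) (hΨ : Ψ.PosSemidef)
    {F : Matrix (Fin N) (Fin L) ℂ}
    (hF : IsBayesPareto σ H Ψ Ω P F) :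
    ∃ X, IsParetoMax (normalizedFeasible (fun i => (σ : ℂ) ^ 2 • Ω i + (P i : ℂ) • Ψ) Ψ P)
        (fun X => (H * X)ᴴ * (H * X)) X ∧
      F = ((σ / √(1 - powerForm Ψ X) : ℝ) : ℂ) • X := by
  obtain ⟨X, hX, rfl⟩ := exists_normalize hσ hΨ hF.1
  refine ⟨X, ⟨hX, fun Z hZ hle => ?_⟩, rfl⟩
  have h := hF.2 _ (powerFeasible_denormalize hZ)
  rw [bayesObjective_denormalize H hσ hΨ hX.2, bayesObjective_denormalize H hσ hΨ hZ.2] at h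
  exact h hle

end normalization

/-- Right multiplication of `F` by a unitary matrix preserves the constraints and `K_n` and conjugates
the objective, so it preserves Pareto optimality. -/
theorem IsBayesPareto.mul_unitary {M N L I : ℕ} {σ : ℝ} {H : Matrix (Fin M) (Fin N) ℂ}
    {Ψ : Matrix (Fin N) (Fin N) ℂ} {Ω : Fin I → Matrix (Fin N) (Fin N) ℂ} {P : Fin I → ℝ}
    {F : Matrix (Fin N) (Fin L) ℂ} (hF : IsBayesPareto σ H Ψ Ω P F)
    {W : Matrix (Fin L) (Fin L) ℂ} (hW : W ∈ Matrix.unitaryGroup (Fin L) ℂ) :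
    IsBayesPareto σ H Ψ Ω P (F * W) := by
  have h1 : W * Wᴴ = 1 := Matrix.mem_unitaryGroup_iff.mp hW
  have h2 : Wᴴ * W = 1 := Matrix.mem_unitaryGroup_iff'.mp hW
  have hgram : ∀ (U : Matrix (Fin L) (Fin L) ℂ), U * Uᴴ = 1 → ∀ Y : Matrix (Fin N) (Fin L) ℂ,
      Y * U * (Y * U)ᴴ = Y * Yᴴ := by
    intro U hU Y
    rw [Matrix.conjTranspose_mul, Matrix.mul_assoc, ← Matrix.mul_assoc U, hU, Matrix.one_mul]
  have hfeas : ∀ (U : Matrix (Fin L) (Fin L) ℂ), U * Uᴴ = 1 → ∀ Y : Matrix (Fin N) (Fin L) ℂ,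
      Y ∈ powerFeasible Ω P → Y * U ∈ powerFeasible Ω P := by
    intro U hU Y hY i
    rw [Matrix.mul_assoc, hgram U hU, ← Matrix.mul_assoc]
    exact hY i
  have hobj : ∀ (U : Matrix (Fin L) (Fin L) ℂ), U * Uᴴ = 1 → ∀ Y : Matrix (Fin N) (Fin L) ℂ,
      bayesObjective σ H Ψ (Y * U) = Uᴴ * bayesObjective σ H Ψ Y * U := by
    intro U hU Y
    have : noiseCov M σ Ψ (Y * U) = noiseCov M σ Ψ Y := by
      rw [noiseCov, noiseCov, hgram U hU]
    simp only [bayesObjective, this, Matrix.conjTranspose_mul, Matrix.mul_assoc]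
  refine ⟨hfeas W h1 F hF.1, fun Y hY hle => ?_⟩
  have h1' : Wᴴ * Wᴴᴴ = 1 := by rwa [Matrix.conjTranspose_conjTranspose]
  have h3 : bayesObjective σ H Ψ (Y * Wᴴ) - bayesObjective σ H Ψ F =
      W * (bayesObjective σ H Ψ Y - bayesObjective σ H Ψ (F * W)) * Wᴴ := by
    rw [hobj _ h1', hobj W h1, Matrix.conjTranspose_conjTranspose, Matrix.mul_sub, Matrix.sub_mul]
    congr 1
    rw [Matrix.mul_assoc, Matrix.mul_assoc, Matrix.mul_assoc, h1, Matrix.mul_one,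
      ← Matrix.mul_assoc, h1, Matrix.one_mul]
  have h4 := hF.2 _ (hfeas _ h1' Y hY) (by rw [h3]; exact hle.mul_mul_conjTranspose_same W)
  rw [hobj W h1, ← h4, hobj _ h1', Matrix.conjTranspose_conjTranspose, Matrix.mul_assoc,
    Matrix.mul_assoc, Matrix.mul_assoc, h2, Matrix.mul_one, ← Matrix.mul_assoc, h2, Matrix.one_mul]

/-! ### First-order optimality conditions -/

/-- A direction along which each linearized constraint is slack stays feasible for a small positive
step. The slack `P i - powerForm (A i) X` is kept in the hypothesis, so that active and inactive
constraints are treated alike. -/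
theorem exists_pos_add_smul_mem_normalizedFeasible {N L I : ℕ}
    {A : Fin I → Matrix (Fin N) (Fin N) ℂ} (hA : ∀ i, (A i).IsHermitian)
    {Ψ : Matrix (Fin N) (Fin N) ℂ} (hΨ : Ψ.IsHermitian) {P : Fin I → ℝ}
    {X : Matrix (Fin N) (Fin L) ℂ} (hX : X ∈ normalizedFeasible A Ψ P)
    {D : Matrix (Fin N) (Fin L) ℂ}
    (hD : ∀ i, 0 < P i - powerForm (A i) X - 2 * powerPairing (A i) X D) :
    ∃ t : ℝ, 0 < t ∧ X + (t : ℂ) • D ∈ normalizedFeasible A Ψ P := by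
  have h1 : ∀ᶠ t : ℝ in nhdsWithin 0 (Set.Ioi 0), 0 < t ∧ t < 1 := Ioo_mem_nhdsGT one_pos
  have h2 : ∀ᶠ t : ℝ in nhdsWithin 0 (Set.Ioi 0), ∀ i,
      t * powerForm (A i) D < P i - powerForm (A i) X - 2 * powerPairing (A i) X D := by
    rw [Filter.eventually_all]
    intro i
    have hc : Filter.Tendsto (fun t : ℝ => t * powerForm (A i) D) (nhdsWithin 0 (Set.Ioi 0))
        (nhds (0 * powerForm (A i) D)) :=
      ((continuous_id.mul continuous_const).tendsto 0).mono_left nhdsWithin_le_nhds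
    rw [zero_mul] at hc
    exact hc.eventually_lt_const (hD i)
  have h3 : ∀ᶠ t : ℝ in nhdsWithin 0 (Set.Ioi 0), powerForm Ψ (X + (t : ℂ) • D) < 1 := by
    simp_rw [powerForm_add_smul hΨ]
    have hc : Continuous fun t : ℝ =>
        powerForm Ψ X + 2 * t * powerPairing Ψ X D + t ^ 2 * powerForm Ψ D := by fun_prop
    have h := (hc.tendsto 0).mono_left (nhdsWithin_le_nhds (s := Set.Ioi 0))
    refine h.eventually_lt_const ?_
    simpa using hX.2
  obtain ⟨t, ⟨ht0, ht1⟩, ht2, ht3⟩ := (h1.and (h2.and h3)).exists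
  refine ⟨t, ht0, fun i => ?_, ht3⟩
  rw [powerForm_add_smul (hA i)]
  nlinarith [hX.1 i, ht2 i]

/-- First-order optimality. Call `E` admissible if `(H X)ᴴ (H E)` is skew-Hermitian, that is, if the
objective is stationary at `X` in the direction `E`. A step from `X` along `X + E` with `E`
admissible dominates `X` strictly, hence it violates some linearized constraint; separating the
convex set of linearized slacks from the open positive orthant of `ℝ^I` gives the weights. -/
theorem exists_multipliers {M N L I : ℕ} (H : Matrix (Fin M) (Fin N) ℂ)
    {A : Fin I → Matrix (Fin N) (Fin N) ℂ} (hA : ∀ i, (A i).IsHermitian)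
    {Ψ : Matrix (Fin N) (Fin N) ℂ} (hΨ : Ψ.IsHermitian) {P : Fin I → ℝ}
    {X : Matrix (Fin N) (Fin L) ℂ}
    (hX : IsParetoMax (normalizedFeasible A Ψ P) (fun X => (H * X)ᴴ * (H * X)) X)
    (hHX : H * X ≠ 0) :
    ∃ α : Fin I → ℝ, (∀ i, 0 ≤ α i) ∧ (∃ i, 0 < α i) ∧
      ∀ E : Matrix (Fin N) (Fin L) ℂ, (H * X)ᴴ * (H * E) + (H * E)ᴴ * (H * X) = 0 →
        powerPairing (∑ i, (α i : ℂ) • A i) X E = 0 := by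
  classical
  let V : Set (Matrix (Fin N) (Fin L) ℂ) := {E | (H * X)ᴴ * (H * E) + (H * E)ᴴ * (H * X) = 0}
  have hVsmul : ∀ (t : ℝ), ∀ E ∈ V, (t : ℂ) • E ∈ V := by
    intro t E hE
    change (H * X)ᴴ * (H * ((t : ℂ) • E)) + (H * ((t : ℂ) • E))ᴴ * (H * X) = 0
    simp only [Matrix.mul_smul, Matrix.smul_mul, Matrix.conjTranspose_smul, Complex.star_def,
      Complex.conj_ofReal, ← smul_add]
    rw [show (H * X)ᴴ * (H * E) + (H * E)ᴴ * (H * X) = 0 from hE, smul_zero]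
  have hVadd : ∀ E ∈ V, ∀ E' ∈ V, E + E' ∈ V := by
    intro E hE E' hE'
    have h1 : (H * X)ᴴ * (H * E) + (H * E)ᴴ * (H * X) = 0 := hE
    have h2 : (H * X)ᴴ * (H * E') + (H * E')ᴴ * (H * X) = 0 := hE'
    change (H * X)ᴴ * (H * (E + E')) + (H * (E + E'))ᴴ * (H * X) = 0
    simp only [Matrix.mul_add, Matrix.add_mul, Matrix.conjTranspose_add]
    rw [add_add_add_comm, h1, h2, add_zero]
  let c : Matrix (Fin N) (Fin L) ℂ → Fin I → ℝ := fun E i =>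
    P i - powerForm (A i) X - 2 * powerPairing (A i) X (X + E)
  have hno : ∀ E ∈ V, ¬ ∀ i, 0 < c E i := by
    intro E hE hc
    obtain ⟨t, ht, hfeas⟩ := exists_pos_add_smul_mem_normalizedFeasible hA hΨ hX.1 hc
    -- The cross terms in `E` cancel, so the gain is `2t (HX)ᴴ(HX) + t² (H(X+E))ᴴ(H(X+E)) ⪰ 0`.
    have hgain : (H * (X + (t : ℂ) • (X + E)))ᴴ * (H * (X + (t : ℂ) • (X + E))) -
        (H * X)ᴴ * (H * X) = ((2 * t : ℝ) : ℂ) • ((H * X)ᴴ * (H * X)) +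
          ((t ^ 2 : ℝ) : ℂ) • ((H * (X + E))ᴴ * (H * (X + E))) := by
      have hE' : (H * E)ᴴ * (H * X) = - ((H * X)ᴴ * (H * E)) := by
        rw [eq_neg_iff_add_eq_zero, add_comm]; exact hE
      push_cast
      simp only [Matrix.mul_add, Matrix.add_mul, Matrix.mul_smul, Matrix.smul_mul,
        Matrix.conjTranspose_add, Matrix.conjTranspose_smul, Complex.star_def, Complex.conj_ofReal,
        hE']
      module
    have hpsd1 : 0 ≤ ((2 * t : ℝ) : ℂ) • ((H * X)ᴴ * (H * X)) :=
      ((Matrix.posSemidef_conjTranspose_mul_self _).smul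
        (Complex.zero_le_real.mpr (by positivity))).nonneg
    have hpsd2 : 0 ≤ ((t ^ 2 : ℝ) : ℂ) • ((H * (X + E))ᴴ * (H * (X + E))) :=
      ((Matrix.posSemidef_conjTranspose_mul_self _).smul
        (Complex.zero_le_real.mpr (by positivity))).nonneg
    have heq := hX.2 _ hfeas (by
      change ((H * (X + (t : ℂ) • (X + E)))ᴴ * (H * (X + (t : ℂ) • (X + E))) -
        (H * X)ᴴ * (H * X)).PosSemidef
      rw [hgain]
      exact Matrix.nonneg_iff_posSemidef.mp (add_nonneg hpsd1 hpsd2))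
    rw [← sub_eq_zero, hgain] at heq
    have h0 := (add_eq_zero_iff_of_nonneg hpsd1 hpsd2).mp heq
    rcases smul_eq_zero.mp h0.1 with h | h
    · have : 2 * t = 0 := by exact_mod_cast h
      linarith
    · exact hHX (Matrix.conjTranspose_mul_self_eq_zero.mp h)
  have hconv : Convex ℝ (c '' V) := by
    rintro _ ⟨E, hE, rfl⟩ _ ⟨E', hE', rfl⟩ a b _ _ hab
    refine ⟨(a : ℂ) • E + (b : ℂ) • E', hVadd _ (hVsmul a E hE) _ (hVsmul b E' hE'), ?_⟩
    funext i
    simp only [c, powerPairing_add, powerPairing_smul, Pi.add_apply, Pi.smul_apply, smul_eq_mul]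
    linear_combination (-(P i - powerForm (A i) X) + 2 * powerPairing (A i) X X) * hab
  have hsc : Convex ℝ (Set.univ.pi fun _ : Fin I => Set.Ioi (0 : ℝ)) :=
    convex_pi fun _ _ => convex_Ioi 0
  have hso : IsOpen (Set.univ.pi fun _ : Fin I => Set.Ioi (0 : ℝ)) :=
    isOpen_set_pi Set.finite_univ fun _ _ => isOpen_Ioi
  obtain ⟨f, u, hfs, hft⟩ := geometric_hahn_banach_open hsc hso hconv (by
    rw [Set.disjoint_left]
    rintro _ hs ⟨E, hE, rfl⟩
    exact hno E hE fun i => hs i trivial)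
  have hf : ∀ y, f y = ∑ i, y i * f (Pi.single i 1) := by
    intro y
    conv_lhs => rw [pi_eq_sum_univ' y]
    simp [map_sum]
  have hV0 : (0 : Matrix (Fin N) (Fin L) ℂ) ∈ V := by simp [V]
  have hone : f (fun _ => 1) < u := hfs _ fun i _ => by simp
  have hβ : ∀ i, f (Pi.single i 1) ≤ 0 := by
    intro i
    by_contra! hpos
    obtain ⟨k, hk⟩ := exists_nat_gt ((u - f fun _ => 1) / f (Pi.single i 1))
    rw [div_lt_iff₀ hpos] at hk
    have h := hfs ((fun _ => 1) + (k : ℝ) • Pi.single i 1) (by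
      intro j _
      by_cases hj : j = i
      · subst hj; simp; positivity
      · simp [hj])
    rw [map_add, map_smul, smul_eq_mul] at h
    linarith
  refine ⟨fun i => - f (Pi.single i 1), fun i => neg_nonneg.mpr (hβ i), ?_, ?_⟩
  · by_contra! hall
    have h0 : ∀ i, f (Pi.single i 1) = 0 := fun i =>
      le_antisymm (hβ i) (by linarith [hall i])
    have h1 := hft _ ⟨0, hV0, rfl⟩
    rw [hf] at h1 hone
    simp only [h0, mul_zero, Finset.sum_const_zero] at h1 hone
    linarith
  · intro E hE
    rw [powerPairing_weighted]
    set z := ∑ i, -f (Pi.single i 1) * powerPairing (A i) X E with hz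
    have hline : ∀ τ : ℝ, f (c ((τ : ℂ) • E)) = f (c 0) + 2 * τ * z := by
      intro τ
      rw [hf, hf (c 0), hz, Finset.mul_sum, ← Finset.sum_add_distrib]
      refine Finset.sum_congr rfl fun i _ => ?_
      have h0 : powerPairing (A i) X (0 : Matrix (Fin N) (Fin L) ℂ) = 0 := by simp [powerPairing]
      simp only [c, powerPairing_add, powerPairing_smul, h0]
      ring
    by_contra hz0
    have h := hft _ ⟨_, hVsmul ((u - f (c 0) - 1) / (2 * z)) E hE, rfl⟩
    rw [hline] at h
    have : 2 * ((u - f (c 0) - 1) / (2 * z)) * z = u - f (c 0) - 1 := by field_simp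
    linarith

/-- The multipliers make `Ω̄ X Xᴴ Hᴴ H` Hermitian and `Ω̄ X` orthogonal to the kernel of `H`. The
case `H = 0` is separate: every feasible point is then optimal, and its power may lie anywhere. -/
theorem exists_weights {M N L I : ℕ} (hI : 0 < I) (H : Matrix (Fin M) (Fin N) ℂ)
    {A : Fin I → Matrix (Fin N) (Fin N) ℂ} (hA : ∀ i, (A i).PosDef)
    {Ψ : Matrix (Fin N) (Fin N) ℂ} (hΨ : Ψ.IsHermitian) {P : Fin I → ℝ}
    {X : Matrix (Fin N) (Fin L) ℂ}
    (hX : IsParetoMax (normalizedFeasible A Ψ P) (fun X => (H * X)ᴴ * (H * X)) X) :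
    ∃ α : Fin I → ℝ, (∀ i, 0 ≤ α i) ∧ (∃ i, 0 < α i) ∧
      ((∑ i, (α i : ℂ) • A i) * X * Xᴴ * (Hᴴ * H)).IsHermitian ∧
      ((∀ v, H *ᵥ v = 0 → ((∑ i, (α i : ℂ) • A i) * X)ᴴ *ᵥ v = 0) ∨ H = 0) := by
  classical
  by_cases hHX : H * X = 0
  · refine ⟨fun _ => 1, fun _ => zero_le_one, ⟨⟨0, hI⟩, one_pos⟩, ?_, ?_⟩
    · have : Xᴴ * (Hᴴ * H) = 0 := by
        rw [← Matrix.mul_assoc, ← Matrix.conjTranspose_mul, hHX]; simp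
      rw [Matrix.mul_assoc, this, Matrix.mul_zero]
      exact Matrix.isHermitian_zero
    -- If `H ≠ 0` and `X ≠ 0`, all `P i` are positive and a small nonzero precoder dominates `X`.
    by_contra! hcon
    obtain ⟨⟨v, -, hv⟩, hH⟩ := hcon
    have hX0 : X ≠ 0 := by rintro rfl; simp at hv
    have hP : ∀ i, 0 < P i := fun i => (powerForm_pos (hA i) hX0).trans_le (hX.1.1 i)
    obtain ⟨j⟩ : Nonempty (Fin L) := by
      by_contra hn
      rw [not_nonempty_iff] at hn
      exact hX0 (Subsingleton.elim _ _)
    obtain ⟨i, k, hik⟩ : ∃ i k, H i k ≠ 0 := by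
      by_contra! h
      exact hH (by ext i k; simpa using h i k)
    obtain ⟨t, ht, hfeas⟩ := exists_pos_add_smul_mem_normalizedFeasible (fun i => (hA i).isHermitian)
      hΨ (P := P) (X := 0) (D := Matrix.single k j (1 : ℂ))
      (by simp [normalizedFeasible, powerForm, powerPairing, fun i => (hP i).le])
      (by simp [powerForm, powerPairing, hP])
    have h := hX.2 _ hfeas (by
      simp only [hHX, Matrix.mul_zero, sub_zero]
      exact Matrix.posSemidef_conjTranspose_mul_self _)
    have h2 : H * (0 + (t : ℂ) • Matrix.single k j (1 : ℂ)) = 0 :=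
      Matrix.conjTranspose_mul_self_eq_zero.mp (h.trans (by simp [hHX]))
    rw [zero_add, Matrix.mul_smul] at h2
    rcases smul_eq_zero.mp h2 with h | h
    · exact ht.ne' (by exact_mod_cast h)
    · have := congrFun (congrFun h i) j
      simp at this
      exact hik this
  · obtain ⟨α, hα, hpos, hstat⟩ :=
      exists_multipliers H (fun i => (hA i).isHermitian) hΨ hX hHX
    refine ⟨α, hα, hpos, ?_, Or.inl fun v hv => ?_⟩
    · set W := ∑ i, (α i : ℂ) • A i
      set Z := W * X * Xᴴ * (Hᴴ * H) with hZ
      have hskew : (Z - Zᴴ)ᴴ = -(Z - Zᴴ) := by simp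
      -- `C = Z - Zᴴ` is skew-Hermitian, so `C Hᴴ H X` is admissible, and pairing with it yields
      -- `Tr(C Cᴴ) = 0`.
      have h := hstat ((Z - Zᴴ) * (Hᴴ * H * X)) (by
        simp only [Matrix.conjTranspose_mul, hskew, Matrix.conjTranspose_conjTranspose]
        simp only [Matrix.mul_assoc, Matrix.neg_mul, Matrix.mul_neg]
        exact add_neg_cancel _)
      have hZC : (Z * (Z - Zᴴ)ᴴ).trace.re = 0 := by
        rw [← h, powerPairing, hZ]
        congr 2
        simp only [Matrix.conjTranspose_mul, Matrix.conjTranspose_conjTranspose, Matrix.mul_assoc]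
      have hZC' : (Zᴴ * (Z - Zᴴ)ᴴ).trace.re = 0 := by
        have : (Zᴴ * (Z - Zᴴ)ᴴ).trace = - star (Z * (Z - Zᴴ)ᴴ).trace := by
          rw [← Matrix.trace_conjTranspose, Matrix.conjTranspose_mul Z,
            Matrix.conjTranspose_conjTranspose, hskew, Matrix.mul_neg, Matrix.trace_neg,
            Matrix.trace_mul_comm]
        rw [this]
        simp only [Complex.neg_re, Complex.star_def, Complex.conj_re, hZC, neg_zero]
      have hre : ((Z - Zᴴ) * (Z - Zᴴ)ᴴ).trace.re = 0 := by
        rw [Matrix.sub_mul, Matrix.trace_sub, Complex.sub_re, hZC, hZC', sub_zero]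
      have hnn := (Matrix.posSemidef_self_mul_conjTranspose (Z - Zᴴ)).trace_nonneg
      have h0 : ((Z - Zᴴ) * (Z - Zᴴ)ᴴ).trace = 0 :=
        Complex.ext hre (Complex.nonneg_iff.mp hnn).2.symm
      rw [Matrix.trace_mul_conjTranspose_self_eq_zero_iff, sub_eq_zero] at h0
      exact h0.symm
    · set W := ∑ i, (α i : ℂ) • A i
      set B := Matrix.replicateCol Unit v with hB
      have hHB : H * B = 0 := by
        rw [hB, ← Matrix.replicateCol_mulVec, hv]; rfl
      -- A direction with columns in the kernel of `H` is admissible; this one pairs to the squared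
      -- Frobenius norm of `Bᴴ Ω̄ X`.
      have h := hstat (B * (Bᴴ * (W * X))) (by
        rw [← Matrix.mul_assoc H, hHB]; simp)
      have hre : (Bᴴ * (W * X) * (Bᴴ * (W * X))ᴴ).trace.re = 0 := by
        rw [← h, powerPairing, Matrix.conjTranspose_mul B, ← Matrix.mul_assoc (W * X),
          Matrix.trace_mul_comm (W * X * (Bᴴ * (W * X))ᴴ), Matrix.mul_assoc]
      have hnn := (Matrix.posSemidef_self_mul_conjTranspose (Bᴴ * (W * X))).trace_nonneg
      have h0 : (Bᴴ * (W * X) * (Bᴴ * (W * X))ᴴ).trace = 0 :=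
        Complex.ext hre (Complex.nonneg_iff.mp hnn).2.symm
      rw [Matrix.trace_mul_conjTranspose_self_eq_zero_iff] at h0
      have h1 : (W * X)ᴴ * B = 0 := by
        rw [← Matrix.conjTranspose_conjTranspose ((W * X)ᴴ * B), Matrix.conjTranspose_mul,
          Matrix.conjTranspose_conjTranspose, h0, Matrix.conjTranspose_zero]
      rw [hB, ← Matrix.replicateCol_mulVec] at h1
      funext i
      exact congrFun (congrFun h1 i) ()

/-! ### The structure of Pareto optimal solutions -/

theorem weightedOmega_posDef {N I : ℕ} {σ : ℝ} {Ψ : Matrix (Fin N) (Fin N) ℂ}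
    {Ω : Fin I → Matrix (Fin N) (Fin N) ℂ} {P : Fin I → ℝ}
    (hpd : ∀ i, ((σ : ℂ) ^ 2 • Ω i + (P i : ℂ) • Ψ).PosDef) {α : Fin I → ℝ} (hα : ∀ i, 0 ≤ α i)
    (hpos : ∃ i, 0 < α i) : (weightedOmega σ Ψ Ω P α).PosDef := by
  classical
  obtain ⟨i, hi⟩ := hpos
  rw [weightedOmega, ← Finset.add_sum_erase _ _ (Finset.mem_univ i)]
  refine ((hpd i).smul (by exact_mod_cast hi)).add_posSemidef ?_
  exact Matrix.posSemidef_sum _ fun j _ => (hpd j).posSemidef.smul (by exact_mod_cast hα j)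

/-- For positive definite `W`, `invSqrt W` is the Hermitian inverse of a Hermitian square root of `W`. -/
theorem Matrix.PosDef.invSqrt_spec {N : ℕ} {W : Matrix (Fin N) (Fin N) ℂ} (hW : W.PosDef) :
    ∃ R : Matrix (Fin N) (Fin N) ℂ, R.IsHermitian ∧ (invSqrt W).IsHermitian ∧ R * R = W ∧
      R * invSqrt W = 1 ∧ invSqrt W * R = 1 := by
  have hnn : 0 ≤ W := hW.posSemidef.nonneg
  have hR : (CFC.sqrt W).IsHermitian :=
    (Matrix.nonneg_iff_posSemidef.mp (CFC.sqrt_nonneg W)).isHermitian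
  have hRR : CFC.sqrt W * CFC.sqrt W = W := CFC.sqrt_mul_sqrt_self W
  have hu : IsUnit (CFC.sqrt W).det := by
    have h := (Matrix.isUnit_iff_isUnit_det _).mp hW.isUnit
    rw [← hRR, Matrix.det_mul] at h
    exact isUnit_of_mul_isUnit_left h
  exact ⟨CFC.sqrt W, hR, hR.inv, hRR, Matrix.mul_nonsing_inv _ hu, Matrix.nonsing_inv_mul _ hu⟩

/-- With `R = Ω̄^{1/2}`, the two conclusions of `exists_weights` say that `(R X)(R X)ᴴ` commutes with
the Gram matrix of `H Ω̄^{-1/2}` and that the relevant kernels are nested, so `R X` and `H Ω̄^{-1/2}`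
share a singular vector basis. -/
theorem exists_svd_factorization {M N L : ℕ} {W : Matrix (Fin N) (Fin N) ℂ} (hW : W.PosDef)
    (H : Matrix (Fin M) (Fin N) ℂ) (X : Matrix (Fin N) (Fin L) ℂ)
    (hherm : (W * X * Xᴴ * (Hᴴ * H)).IsHermitian)
    (hker : (∀ v, H *ᵥ v = 0 → (W * X)ᴴ *ᵥ v = 0) ∨ H = 0) :
    ∃ U_H Λ_H V, ∃ Λ : Matrix (Fin N) (Fin L) ℂ, ∃ U ∈ Matrix.unitaryGroup (Fin L) ℂ,
      IsSVD (H * invSqrt W) U_H Λ_H V ∧ IsNonnegRectDiag Λ ∧ X = invSqrt W * V * Λ * Uᴴ := by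
  obtain ⟨R, hR, hS, hRR, hRS, hSR⟩ := hW.invSqrt_spec
  set S := invSqrt W with hSdef
  have hRS' : ∀ {k : ℕ} (Z : Matrix (Fin N) (Fin k) ℂ), R * (S * Z) = Z := fun Z => by
    rw [← Matrix.mul_assoc, hRS, Matrix.one_mul]
  have hSR' : ∀ {k : ℕ} (Z : Matrix (Fin N) (Fin k) ℂ), S * (R * Z) = Z := fun Z => by
    rw [← Matrix.mul_assoc, hSR, Matrix.one_mul]
  have hcomm : Commute ((H * S)ᴴ * (H * S)) ((R * X)ᴴᴴ * (R * X)ᴴ) := by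
    have h : S * (W * X * Xᴴ * (Hᴴ * H))ᴴ * S = S * (W * X * Xᴴ * (Hᴴ * H)) * S := by rw [hherm.eq]
    rw [← hRR] at h
    simp only [Matrix.conjTranspose_mul, Matrix.conjTranspose_conjTranspose, hR.eq,
      Matrix.mul_assoc, hSR', hRS, Matrix.mul_one] at h
    rw [commute_iff_eq]
    simp only [Matrix.conjTranspose_mul, Matrix.conjTranspose_conjTranspose, hR.eq, hS.eq,
      Matrix.mul_assoc, hSR', hRS']
    exact h
  obtain ⟨U_H, Λ_H, U, Λ, V, hA, hU, -, hΛ, hY⟩ := exists_isSVD_common (H * S) (R * X)ᴴ hcomm (by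
    refine hker.imp (fun h v hv => ?_) (fun h v _ => by simp [h])
    rw [← Matrix.mulVec_mulVec] at hv
    have h1 := h _ hv
    rwa [← hRR, Matrix.mulVec_mulVec, Matrix.mul_assoc R, Matrix.conjTranspose_mul R, hR.eq,
      Matrix.mul_assoc, hRS, Matrix.mul_one] at h1)
  refine ⟨U_H, Λ_H, V, Λᴴ, U, hU, hA, fun i j => ⟨?_, fun hij => ?_⟩, ?_⟩
  · exact star_nonneg_iff.mpr (hΛ j i).1
  · rw [Matrix.conjTranspose_apply, (hΛ j i).2 (Ne.symm hij), star_zero]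
  · have h := congrArg Matrix.conjTranspose hY
    simp only [Matrix.conjTranspose_mul, Matrix.conjTranspose_conjTranspose] at h
    rw [← hSR' X]
    simp only [Matrix.mul_assoc, h]

/-- The bracket is `1 - Tr(Ψ X Xᴴ)` for the normalized solution `X`; in particular it does not depend
on the arbitrary unitary factor. -/
theorem structureGap_eq {N L : ℕ} (Ψ : Matrix (Fin N) (Fin N) ℂ) {W : Matrix (Fin N) (Fin N) ℂ}
    (hW : W.PosDef) (V : Matrix (Fin N) (Fin N) ℂ) (Λ : Matrix (Fin N) (Fin L) ℂ)
    {U : Matrix (Fin L) (Fin L) ℂ} (hU : U ∈ Matrix.unitaryGroup (Fin L) ℂ) :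
    structureGap Ψ W V Λ = 1 - powerForm Ψ (invSqrt W * V * Λ * Uᴴ) := by
  obtain ⟨-, -, hS, -⟩ := hW.invSqrt_spec
  have hU' : ∀ Z : Matrix (Fin L) (Fin N) ℂ, Uᴴ * (U * Z) = Z := fun Z => by
    rw [← Matrix.mul_assoc, ← Matrix.star_eq_conjTranspose, Matrix.mem_unitaryGroup_iff'.mp hU,
      Matrix.one_mul]
  rw [structureGap, powerForm, powerPairing]
  congr 2
  simp only [Matrix.conjTranspose_mul, Matrix.conjTranspose_conjTranspose, hS.eq,
    Matrix.mul_assoc, hU']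
  rw [Matrix.trace_mul_comm (invSqrt W)]
  simp only [Matrix.mul_assoc]

theorem lemma4 (M N L I : ℕ) (hI : 0 < I) (σ : ℝ) (hσ : 0 < σ)
    (H : Matrix (Fin M) (Fin N) ℂ)
    (Ψ : Matrix (Fin N) (Fin N) ℂ) (hΨ : Ψ.PosSemidef)
    (Ω : Fin I → Matrix (Fin N) (Fin N) ℂ) (hΩ : ∀ i, (Ω i).PosSemidef)
    (P : Fin I → ℝ)
    (hpd : ∀ i, ((σ : ℂ) ^ 2 • Ω i + (P i : ℂ) • Ψ).PosDef)
    (F : Matrix (Fin N) (Fin L) ℂ) (hF : IsBayesPareto σ H Ψ Ω P F) :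
    ∃ α : Fin I → ℝ, (∀ i, 0 ≤ α i) ∧ (weightedOmega σ Ψ Ω P α).PosDef ∧
      ∃ (U_H : Matrix (Fin M) (Fin M) ℂ) (Λ_H : Matrix (Fin M) (Fin N) ℂ)
        (V_H : Matrix (Fin N) (Fin N) ℂ) (Λ : Matrix (Fin N) (Fin L) ℂ),
        IsSVD (H * invSqrt (weightedOmega σ Ψ Ω P α)) U_H Λ_H V_H ∧
        IsNonnegRectDiag Λ ∧
        0 < structureGap Ψ (weightedOmega σ Ψ Ω P α) V_H Λ ∧
        (∃ U_Arb ∈ Matrix.unitaryGroup (Fin L) ℂ,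
          F = structuredSolution σ Ψ (weightedOmega σ Ψ Ω P α) V_H Λ U_Arb) ∧
        (∀ U_Arb ∈ Matrix.unitaryGroup (Fin L) ℂ,
          IsBayesPareto σ H Ψ Ω P
            (structuredSolution σ Ψ (weightedOmega σ Ψ Ω P α) V_H Λ U_Arb)) := by
  obtain ⟨X, hX, rfl⟩ := hF.exists_normalized H hσ hΨ
  obtain ⟨α, hα, hpos, hherm, hker⟩ := exists_weights hI H hpd hΨ.isHermitian hX
  have hW := weightedOmega_posDef hpd hα hpos
  obtain ⟨U_H, Λ_H, V, Λ, U, hU, hsvd, hΛ, hXeq⟩ := exists_svd_factorization hW H X hherm hker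
  have hgap : structureGap Ψ (weightedOmega σ Ψ Ω P α) V Λ = 1 - powerForm Ψ X := by
    rw [structureGap_eq Ψ hW V Λ hU, ← hXeq]
  have hsol : ((σ / √(1 - powerForm Ψ X) : ℝ) : ℂ) • X =
      structuredSolution σ Ψ (weightedOmega σ Ψ Ω P α) V Λ U := by
    rw [structuredSolution, hgap, ← hXeq]
  refine ⟨α, hα, hW, U_H, Λ_H, V, Λ, hsvd, hΛ, ?_, ⟨U, hU, hsol⟩, fun U' hU' => ?_⟩
  · rw [hgap]; linarith [hX.1.2]
  · have h : structuredSolution σ Ψ (weightedOmega σ Ψ Ω P α) V Λ U' =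
        structuredSolution σ Ψ (weightedOmega σ Ψ Ω P α) V Λ U * (U * U'ᴴ) := by
      rw [structuredSolution, structuredSolution, Matrix.smul_mul, Matrix.mul_assoc _ Uᴴ,
        ← Matrix.mul_assoc Uᴴ, ← Matrix.star_eq_conjTranspose U,
        Matrix.mem_unitaryGroup_iff'.mp hU, Matrix.one_mul]
    rw [h, ← hsol]
    exact hF.mul_unitary (mul_mem hU (Unitary.star_mem hU'))
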